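/- Let $\mathbb T$ be the circle group with normalized Haar measure $m$, $\mathrm e_n(z)=z^n$ its characters ($n\in\mathbb Z$) and $\widehat f(n)=\int f\,\overline{\mathrm e_n}\,dm$. A *homogeneous Banach space on $\mathbb T$* is a complex linear subspace $X$ of $L^1(\mathbb T)$ with a complete norm satisfying $\|f\|_X\ge\|f\|_{L^1}$, such that for every $f\in X$ all translates $f_s=f(\cdot\, s^{-1})$, $s\in\mathbb T$, belong to $X$, $\|f_s\|_X=\|f\|_X$, and $s\mapsto f_s$ is continuous from $\mathbb T$ to $X$. For $E\subseteq\mathbb Z$ let $X_E=\{f\in X:\widehat f(n)=0 \text{ for all } n\notin E\}$, with the norm of $X$; for $X=\mathcal C(\mathbb T)$ with the sup norm this is $\mathcal C_E(\mathbb T)$. A complex Banach space $Y$ has the *real metric unconditional approximation property* (real umap) if for every $\delta>0$ there are bounded finite rank operators $T_1,T_2,\dots$ on $Y$ with $\|T_kx-x\|\to0$ for every $x\in Y$ such that, with $T_0=0$, $$\Bigl\|\sum_{k=1}^n\epsilon_k(T_k-T_{k-1})\Bigr\|\le 1+\delta\quad\text{for all } n\ge1 \text{ and } \epsilon_1,\dots,\epsilon_n\in\{-1,1\}.$$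 **Proposition.** Let $E=\{n_k\}\subseteq\mathbb Z$ be a sequence of integers such that $n_{k+1}/n_k$ is an odd integer for all sufficiently large $k$. Then $\mathcal C_E(\mathbb T)$ has real umap, and moreover $X_E$ has real umap for every homogeneous Banach space $X$ on $\mathbb T$. In particular, $\mathcal C_{\{3^k\}}(\mathbb T)$, with $\{3^k\}=\{3^k:k\ge0\}$, has real umap. -/

import Mathlib

open MeasureTheory Filter Topology

namespace UnconditionalApproximation

instance instFactTwoPiPos : Fact (0 < 2 * Real.pi) := ⟨Real.two_pi_pos⟩

/-- The circle group `𝕋`, written additively as `ℝ / 2πℤ` (identified with `{z : |z| = 1}` through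
`t ↦ exp (i t)`). The characters are `fourier n : t ↦ exp (i n t)` for `n : ℤ`, and
`AddCircle.haarAddCircle` is the normalized Haar measure. -/
abbrev Torus : Type := AddCircle (2 * Real.pi)

/-- The space `L¹(𝕋)` of complex functions, for the normalized Haar measure. -/
abbrev L1 : Type := Lp ℂ 1 (AddCircle.haarAddCircle : Measure Torus)

section ApproximationProperty

variable {Y : Type*} [NormedAddCommGroup Y] [NormedSpace ℂ Y]

/-- An approximating sequence: finite rank bounded operators `T 1, T 2, …` that converge
pointwise to the identity, with the convention `T 0 = 0`. -/
structure IsApproximatingSequence (T : ℕ → Y →L[ℂ] Y) : Prop where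
  zero : T 0 = 0
  finiteRank : ∀ k, FiniteDimensional ℂ (LinearMap.range (T k : Y →ₗ[ℂ] Y))
  tendsto : ∀ x, Tendsto (fun k => T k x) atTop (𝓝 x)

variable (Y) in
/-- `Y` has the unconditional approximation property with constant `C`, for signs in `S`:
there is an approximating sequence with
`‖∑_{k=1}^n ε_k (T_k - T_{k-1})‖ ≤ C` for all `n` and all signs `ε_k ∈ S`. -/
def HasUAPWith (S : Set ℂ) (C : ℝ) : Prop :=
  ∃ T : ℕ → Y →L[ℂ] Y, IsApproximatingSequence T ∧
    ∀ (n : ℕ) (ε : ℕ → ℂ), (∀ k, ε k ∈ S) →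
      ‖∑ k ∈ Finset.Icc 1 n, ε k • (T k - T (k - 1))‖ ≤ C

variable (Y) in
/-- The metric unconditional approximation property for signs in `S`: the unconditional
approximation property holds with constant `1 + δ` for every `δ > 0`. -/
def HasUMAP (S : Set ℂ) : Prop :=
  ∀ δ : ℝ, 0 < δ → HasUAPWith Y S (1 + δ)

variable (Y) in
/-- The real metric unconditional approximation property: the signs are `-1` and `1`. -/
def HasRealUMAP : Prop := HasUMAP Y {-1, 1}

end ApproximationProperty

/-- The space `C_E(𝕋)` of continuous functions, with the sup norm, whose Fourier transform
vanishes off `E`. -/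
noncomputable def continuousWithSpectrum (E : Set ℤ) : Submodule ℂ C(Torus, ℂ) where
  carrier := {f | ∀ n ∉ E, fourierCoeff (f : Torus → ℂ) n = 0}
  zero_mem' := fun n _ => by simp [fourierCoeff]
  add_mem' := fun {f g} hf hg n hn => by
    have hi : ∀ h : C(Torus, ℂ), Integrable h AddCircle.haarAddCircle := fun h =>
      h.continuous.integrable_of_hasCompactSupport (HasCompactSupport.of_compactSpace h)
    have := congrFun (fourierCoeff.add (hi f) (hi g)) n
    rw [Pi.add_apply, hf n hn, hg n hn, add_zero] at this
    exact this
  smul_mem' := fun c f hf n hn => by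
    have := fourierCoeff.const_smul (f : Torus → ℂ) c n
    rw [hf n hn, smul_zero] at this
    exact this

/-- `ι` realizes the Banach space `X` as a homogeneous Banach space on `𝕋`, in the sense of
Katznelson: `X` is a linear subspace of `L¹(𝕋)` with a norm that dominates the `L¹` norm; for
every `f` in `X` all translates `f_s = f (· - s)` belong to `X` and have the same norm as `f`;
and `s ↦ f_s` is continuous from `𝕋` to `X`. -/
structure IsHomogeneous {X : Type*} [NormedAddCommGroup X] [NormedSpace ℂ X]
    (ι : X →ₗ[ℂ] L1) : Prop where
  injective : Function.Injective ι
  norm_le : ∀ f, ‖ι f‖ ≤ ‖f‖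
  translation : ∀ f : X, ∃ τ : Torus → X, Continuous τ ∧
    ∀ s, ‖τ s‖ = ‖f‖ ∧ ι (τ s) =ᵐ[AddCircle.haarAddCircle] fun t => ι f (t - s)

/-- The space `X_E` of the elements of `X` whose Fourier transform vanishes off `E`, where `X` is
a space of integrable functions through `ι`. -/
noncomputable def withSpectrum {X : Type*} [NormedAddCommGroup X] [NormedSpace ℂ X]
    (ι : X →ₗ[ℂ] L1) (E : Set ℤ) : Submodule ℂ X where
  carrier := {f | ∀ n ∉ E, fourierCoeff (ι f : Torus → ℂ) n = 0}
  zero_mem' := fun n _ => by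
    rw [map_zero, fourierCoeff_congr_ae (Lp.coeFn_zero ℂ 1 _)]
    simp [fourierCoeff]
  add_mem' := fun {f g} hf hg n hn => by
    have := congrFun (fourierCoeff.add (L1.integrable_coeFn (ι f))
      (L1.integrable_coeFn (ι g))) n
    rw [Pi.add_apply, hf n hn, hg n hn, add_zero] at this
    rw [map_add, fourierCoeff_congr_ae (Lp.coeFn_add _ _)]
    exact this
  smul_mem' := fun c f hf n hn => by
    have := fourierCoeff.const_smul (ι f : Torus → ℂ) c n
    rw [hf n hn, smul_zero] at this
    rw [map_smul, fourierCoeff_congr_ae (Lp.coeFn_smul _ _)]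
    exact this

end UnconditionalApproximation

open UnconditionalApproximation

namespace UnconditionalApproximation

/-! Translation by `π / n k` multiplies the character of frequency `n j` by `-1` for every large `k`
and `j ≥ k`, because `n j / n k` is then odd. If `U` is this translation, `S = (1 + U) / 2` has
finite rank on `X_E`, and `1 - 2 S = -U` is an isometry. If `E` is infinite, `π / n k → 0`, so these
operators converge pointwise to the identity; a finite `E` gives a finite-dimensional space.

It remains to pass from `‖1 - 2 S k‖ ≤ 1` to unconditionality
(`hasRealUMAP_of_norm_one_sub_two_smul_le`). Along a sparse subsequence `T` of `S`, `1 - T (n + 1)`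
nearly annihilates the earlier `T j`. Changing sign after step `n + 1` then amounts, up to a small
error, to composing with the contraction `1 - 2 T (n + 1)`, and the errors are summable. -/

theorem eq_neg_one_or_eq_one {c : ℂ} (hc : c ∈ ({-1, 1} : Set ℂ)) : c = -1 ∨ c = 1 := hc

/-! ### From near-reflections to real unconditionality -/

section Abstract

variable {Y : Type*} [NormedAddCommGroup Y] [NormedSpace ℂ Y]

/-- Operators that converge pointwise to the identity do so uniformly on the unit ball of
a finite-dimensional subspace. -/
theorem tendsto_norm_one_sub_mul_of_finiteDimensional_range {S : ℕ → Y →L[ℂ] Y}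
    (hS : ∀ x, Tendsto (fun k => S k x) atTop (𝓝 x)) (R : Y →L[ℂ] Y)
    [FiniteDimensional ℂ (LinearMap.range (R : Y →ₗ[ℂ] Y))] :
    Tendsto (fun k => ‖(1 - S k) * R‖) atTop (𝓝 0) := by
  set W := LinearMap.range (R : Y →ₗ[ℂ] Y)
  let R' : Y →L[ℂ] W := R.codRestrict W fun x => LinearMap.mem_range_self _ x
  let u : ℕ → W →L[ℂ] Y := fun k => (1 - S k).comp W.subtypeL
  have hu : Tendsto (fun k => ‖u k‖) atTop (𝓝 0) := by
    let v := Module.finBasis ℂ W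
    obtain ⟨C, hC, hv⟩ := v.exists_opNorm_le (F := Y)
    have hb : Tendsto (fun k => C * ∑ i, ‖u k (v i)‖) atTop (𝓝 0) := by
      have h : ∀ i, Tendsto (fun k => ‖u k (v i)‖) atTop (𝓝 0) := fun i => by
        have := (tendsto_const_nhds (x := (v i : Y))).sub (hS (v i))
        rw [sub_self] at this
        simpa [u] using this.norm
      simpa using (tendsto_finsetSum Finset.univ fun i _ => h i).const_mul C
    refine squeeze_zero (fun k => norm_nonneg (u k)) (fun k => ?_) hb
    exact hv (Finset.sum_nonneg fun i _ => norm_nonneg _) fun i =>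
      Finset.single_le_sum (f := fun i => ‖u k (v i)‖) (fun j _ => norm_nonneg _)
        (Finset.mem_univ i)
  have hlim : Tendsto (fun k => ‖u k‖ * ‖R'‖) atTop (𝓝 0) := by
    simpa using hu.mul_const ‖R'‖
  refine squeeze_zero (fun k => norm_nonneg _) (fun k => ?_) hlim
  have : (1 - S k) * R = (u k).comp R' := by ext x; rfl
  rw [this]
  exact ContinuousLinearMap.opNorm_comp_le _ _

/-- The signed sum of the increments of `T`, completed by the signed remainder. -/
noncomputable def signedSum (T : ℕ → Y →L[ℂ] Y) (ε : ℕ → ℂ) (n : ℕ) : Y →L[ℂ] Y :=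
  ∑ k ∈ Finset.Icc 1 n, ε k • (T k - T (k - 1)) + ε (n + 1) • (1 - T n)

theorem signedSum_succ (T : ℕ → Y →L[ℂ] Y) (ε : ℕ → ℂ) (n : ℕ) :
    signedSum T ε (n + 1) = signedSum T ε n + (ε (n + 2) - ε (n + 1)) • (1 - T (n + 1)) := by
  simp only [signedSum, Finset.sum_Icc_succ_top (Nat.le_add_left 1 n), Nat.add_sub_cancel]
  module

/-- The increments telescope to `T n`. So, up to a multiple of the identity, the completed sum
involves only `T j` with `j ≤ n`, which `1 - T (n + 1)` almost kills. -/
theorem signedSum_sub_smul_one (T : ℕ → Y →L[ℂ] Y) (hT : T 0 = 0) (ε : ℕ → ℂ) (n : ℕ) :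
    signedSum T ε n - ε (n + 1) • 1 =
      ∑ k ∈ Finset.Icc 1 n, (ε k - ε (n + 1)) • (T k - T (k - 1)) := by
  have htel : ∑ k ∈ Finset.Icc 1 n, (T k - T (k - 1)) = T n := by
    induction n with
    | zero => simp [hT]
    | succ n ih => rw [Finset.sum_Icc_succ_top (Nat.le_add_left 1 n), ih]; simp
  simp only [sub_smul, Finset.sum_sub_distrib, ← Finset.smul_sum, htel, signedSum]
  module

theorem norm_signedSum_succ_le {T : ℕ → Y →L[ℂ] Y} (hT : T 0 = 0) {ε : ℕ → ℂ}
    (hε : ∀ k, ε k ∈ ({-1, 1} : Set ℂ)) {n : ℕ} {η : ℝ}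
    (hrefl : ‖1 - (2 : ℂ) • T (n + 1)‖ ≤ 1) (hη : ∀ j ≤ n, ‖(1 - T (n + 1)) * T j‖ ≤ η) :
    ‖signedSum T ε (n + 1)‖ ≤ ‖signedSum T ε n‖ + 8 * n * η := by
  have hη0 : 0 ≤ η := (norm_nonneg _).trans (hη 0 (Nat.zero_le _))
  have hεn : ∀ k, ‖ε k‖ = 1 := fun k => by
    rcases eq_neg_one_or_eq_one (hε k) with h | h <;> simp [h]
  have hcases : ε (n + 2) = ε (n + 1) ∨ ε (n + 2) = -ε (n + 1) := by
    rcases eq_neg_one_or_eq_one (hε (n + 1)) with h | h <;>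
      rcases eq_neg_one_or_eq_one (hε (n + 2)) with h' | h' <;> simp [h, h']
  rcases hcases with h | h
  · rw [signedSum_succ, h, sub_self, zero_smul, add_zero]
    exact le_add_of_nonneg_right (by positivity)
  · set P := signedSum T ε n with hP
    -- When the sign flips, the recursion subtracts `2 ε (n + 1) (1 - T (n + 1))`. This rewriting
    -- isolates a contraction applied to `P` and a small remainder.
    have hid : signedSum T ε (n + 1) = -((1 - (2 : ℂ) • T (n + 1)) * P) +
        (2 : ℂ) • ((1 - T (n + 1)) * (P - ε (n + 1) • 1)) := by
      rw [signedSum_succ, h, ← hP]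
      simp only [sub_mul, mul_sub, one_mul, mul_one, smul_mul_assoc, mul_smul_comm]
      module
    have h1 : ‖(1 - (2 : ℂ) • T (n + 1)) * P‖ ≤ ‖P‖ :=
      (norm_mul_le _ _).trans (mul_le_of_le_one_left (norm_nonneg _) hrefl)
    have h2 : ‖(1 - T (n + 1)) * (P - ε (n + 1) • 1)‖ ≤ n * (4 * η) := by
      rw [hP, signedSum_sub_smul_one T hT, Finset.mul_sum]
      refine (norm_sum_le_of_le _ (f := fun _ => _) (n := fun _ => 4 * η)
        fun k hk => ?_).trans (by simp)
      rw [Finset.mem_Icc] at hk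
      rw [mul_smul_comm, norm_smul, mul_sub]
      have hs : ‖ε k - ε (n + 1)‖ ≤ 2 :=
        (norm_sub_le _ _).trans (by rw [hεn, hεn]; norm_num)
      have ht := (norm_sub_le ((1 - T (n + 1)) * T k) ((1 - T (n + 1)) * T (k - 1))).trans
        (add_le_add (hη k hk.2) (hη (k - 1) (by omega)))
      calc _ ≤ 2 * (η + η) := mul_le_mul hs ht (norm_nonneg _) zero_le_two
        _ = 4 * η := by ring
    rw [hid]
    refine (norm_add_le _ _).trans ?_
    rw [norm_neg, norm_smul, Complex.norm_ofNat]
    linarith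

/-- A sequence of finite rank operators `S k` converging pointwise to the identity such that
all `1 - 2 S k` are contractions yields the real metric unconditional approximation property. -/
theorem hasRealUMAP_of_norm_one_sub_two_smul_le {S : ℕ → Y →L[ℂ] Y}
    (hfin : ∀ k, FiniteDimensional ℂ (LinearMap.range (S k : Y →ₗ[ℂ] Y)))
    (hlim : ∀ x, Tendsto (fun k => S k x) atTop (𝓝 x))
    (hrefl : ∀ k, ‖1 - (2 : ℂ) • S k‖ ≤ 1) : HasRealUMAP Y := by
  intro δ hδ
  -- Chosen so that the error `8 n η n` of step `n + 1` is at most `δ / 2 ^ (n + 1)`; these add up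
  -- to less than `δ`.
  let η : ℕ → ℝ := fun n => δ / (8 * (n + 1) * 2 ^ (n + 1))
  have hηpos : ∀ n, 0 < η n := fun n => by positivity
  have hηanti : Antitone η := fun m n hmn => by
    have : (m : ℝ) ≤ n := by exact_mod_cast hmn
    simp only [η]
    gcongr
    norm_num
  have hnext : ∀ M, ∃ N, M < N ∧ ∀ m ≤ M, ‖(1 - S N) * S m‖ ≤ η M := fun M => by
    have h : ∀ᶠ N in atTop, ∀ m ∈ Set.Iic M, ‖(1 - S N) * S m‖ ≤ η M := by
      rw [eventually_all_finite (Set.finite_Iic M)]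
      intro m _
      have := hfin m
      exact (tendsto_norm_one_sub_mul_of_finiteDimensional_range hlim (S m)).eventually_le_const
        (hηpos M)
    exact ((eventually_gt_atTop M).and h).exists
  choose next hlt hnext using hnext
  let φ : ℕ → ℕ := fun n => next^[n] 0
  have hφsucc : ∀ n, φ (n + 1) = next (φ n) := fun n => Function.iterate_succ_apply' _ _ _
  have hφ : StrictMono φ := strictMono_nat_of_lt_succ fun n => by rw [hφsucc]; exact hlt _
  -- The value at `0` is reset because `S (φ 0)` need not vanish.
  let T : ℕ → Y →L[ℂ] Y := fun n => if n = 0 then 0 else S (φ n)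
  have hT0 : T 0 = 0 := if_pos rfl
  have hTs : ∀ n, n ≠ 0 → T n = S (φ n) := fun n hn => if_neg hn
  have happ : IsApproximatingSequence T := by
    refine ⟨hT0, fun k => ?_, fun x => ?_⟩
    · by_cases hk : k = 0
      · rw [hk, hT0, ContinuousLinearMap.toLinearMap_zero, LinearMap.range_zero]
        infer_instance
      · rw [hTs k hk]; exact hfin _
    · refine ((hlim x).comp hφ.tendsto_atTop).congr' ?_
      filter_upwards [eventually_ne_atTop 0] with n hn
      rw [hTs n hn, Function.comp_apply]
  refine ⟨T, happ, fun n ε hε => ?_⟩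
  have hη : ∀ n, ∀ j ≤ n, ‖(1 - T (n + 1)) * T j‖ ≤ η n := fun n j hj => by
    by_cases hj0 : j = 0
    · rw [hj0, hT0, mul_zero, norm_zero]; exact (hηpos n).le
    · rw [hTs j hj0, hTs _ n.succ_ne_zero, hφsucc]
      exact (hnext _ _ (hφ.monotone hj)).trans (hηanti (hφ.id_le n))
  have hbound : ∀ ε' : ℕ → ℂ, (∀ k, ε' k ∈ ({-1, 1} : Set ℂ)) → ∀ n,
      ‖signedSum T ε' n‖ ≤ 1 + δ * (1 - (1 / 2) ^ n) := fun ε' hε' n => by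
    induction n with
    | zero =>
      have : ‖ε' 1‖ = 1 := by rcases eq_neg_one_or_eq_one (hε' 1) with h | h <;> simp [h]
      have h1 : ‖(1 : Y →L[ℂ] Y)‖ ≤ 1 := ContinuousLinearMap.norm_id_le
      simpa [signedSum, hT0, norm_smul, this] using h1
    | succ n ih =>
      refine (norm_signedSum_succ_le hT0 hε'
        (by rw [hTs _ n.succ_ne_zero]; exact hrefl _) (hη n)).trans ?_
      have : 8 * n * η n ≤ δ * (1 / 2) ^ (n + 1) := by
        calc 8 * n * η n ≤ 8 * (n + 1) * η n := by
              have := hηpos n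
              gcongr
              linarith
          _ = δ * (1 / 2) ^ (n + 1) := by
              simp only [η]
              field_simp
              rw [← mul_pow]; norm_num
      rw [pow_succ] at this ⊢
      linarith
  have hle : ∀ ε' : ℕ → ℂ, (∀ k, ε' k ∈ ({-1, 1} : Set ℂ)) →
      ‖signedSum T ε' n‖ ≤ 1 + δ := fun ε' hε' => by
    refine (hbound ε' hε' n).trans ?_
    have : δ * (1 / 2) ^ n ≥ 0 := by positivity
    linarith
  -- Only the sign of the remainder `1 - T n` is left free; averaging over its two values removes
  -- the remainder.
  let εs : ℂ → ℕ → ℂ := fun c k => if k ≤ n then ε k else c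
  have hsum : ∀ c, signedSum T (εs c) n =
      ∑ k ∈ Finset.Icc 1 n, ε k • (T k - T (k - 1)) + c • (1 - T n) := fun c => by
    have : εs c (n + 1) = c := if_neg (by omega)
    rw [signedSum, this]
    congr 1
    refine Finset.sum_congr rfl fun k hk => ?_
    rw [show εs c k = ε k from if_pos (Finset.mem_Icc.1 hk).2]
  have hεs : ∀ c ∈ ({-1, 1} : Set ℂ), ∀ k, εs c k ∈ ({-1, 1} : Set ℂ) := fun c hc k => by
    by_cases hk : k ≤ n
    · rw [show εs c k = ε k from if_pos hk]; exact hε k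
    · rw [show εs c k = c from if_neg hk]; exact hc
  have hhalf : ∑ k ∈ Finset.Icc 1 n, ε k • (T k - T (k - 1)) =
      (2⁻¹ : ℂ) • (signedSum T (εs 1) n + signedSum T (εs (-1)) n) := by
    rw [hsum, hsum]; module
  rw [hhalf, norm_smul]
  have h := (norm_add_le (signedSum T (εs 1) n) (signedSum T (εs (-1)) n)).trans
    (add_le_add (hle _ (hεs 1 (by simp))) (hle _ (hεs (-1) (by simp))))
  norm_num
  linarith

end Abstract

/-! ### Uniqueness of Fourier coefficients -/

/-- The indicator of a closed set is a pointwise limit of continuous functions with values in `[0,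
1]`, so dominated convergence makes the integral over every closed set vanish. -/
theorem ae_eq_zero_of_forall_integral_continuous_mul_eq_zero {Ω : Type*} [TopologicalSpace Ω]
    [MeasurableSpace Ω] [BorelSpace Ω] [HasOuterApproxClosed Ω] {μ : Measure Ω} {f : Ω → ℂ}
    (hf : Integrable f μ) (h : ∀ g : C(Ω, ℂ), ∫ t, g t * f t ∂μ = 0) : f =ᵐ[μ] 0 := by
  refine ae_eq_zero_of_forall_setIntegral_isClosed_eq_zero hf fun s hs => ?_
  have hlim : Tendsto (fun n => ∫ t, ((hs.apprSeq n t : ℝ) : ℂ) * f t ∂μ) atTop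
      (𝓝 (∫ t, s.indicator f t ∂μ)) := by
    refine tendsto_integral_of_dominated_convergence (fun t => ‖f t‖) (fun n => ?_) hf.norm
      (fun n => ?_) ?_
    · have hc : Continuous fun t => ((hs.apprSeq n t : ℝ) : ℂ) := by fun_prop
      exact hc.aestronglyMeasurable.mul hf.aestronglyMeasurable
    · filter_upwards with t
      rw [norm_mul]
      refine mul_le_of_le_one_left (norm_nonneg _) ?_
      have := HasOuterApproxClosed.apprSeq_apply_le_one hs n t
      simpa using this
    · filter_upwards with t
      have h1 := tendsto_pi_nhds.1 (HasOuterApproxClosed.tendsto_apprSeq hs) t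
      have h2 : Tendsto (fun n => ((hs.apprSeq n t : ℝ) : ℂ)) atTop
          (𝓝 (((s.indicator (fun _ => (1 : NNReal)) t : NNReal) : ℝ) : ℂ)) :=
        (Complex.continuous_ofReal.comp NNReal.continuous_coe).continuousAt.tendsto.comp h1
      convert h2.mul_const (f t) using 2
      by_cases ht : t ∈ s <;> simp [ht]
  have hz : ∀ n, ∫ t, ((hs.apprSeq n t : ℝ) : ℂ) * f t ∂μ = 0 := fun n =>
    h ⟨fun t => ((hs.apprSeq n t : ℝ) : ℂ), by fun_prop⟩
  simp only [hz] at hlim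
  rw [← integral_indicator hs.measurableSet]
  exact tendsto_nhds_unique hlim tendsto_const_nhds

/-- Integration against `f` is a continuous functional on `C(𝕋)` that kills the characters, hence
everything, by density of trigonometric polynomials. -/
theorem ae_eq_zero_of_fourierCoeff_eq_zero {f : Torus → ℂ}
    (hf : Integrable f AddCircle.haarAddCircle) (h : ∀ n, fourierCoeff f n = 0) :
    f =ᵐ[AddCircle.haarAddCircle] 0 := by
  refine ae_eq_zero_of_forall_integral_continuous_mul_eq_zero hf fun g => ?_
  have hint : ∀ g : C(Torus, ℂ), Integrable (fun t => g t * f t) AddCircle.haarAddCircle :=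
    fun g => hf.bdd_mul g.continuous.aestronglyMeasurable
      (Eventually.of_forall fun t => g.norm_coe_le_norm t)
  let Φ : C(Torus, ℂ) →ₗ[ℂ] ℂ :=
    { toFun := fun g => ∫ t, g t * f t ∂AddCircle.haarAddCircle
      map_add' := fun g₁ g₂ => by
        rw [← integral_add (hint g₁) (hint g₂)]
        simp only [ContinuousMap.add_apply, add_mul]
      map_smul' := fun c g => by
        rw [RingHom.id_apply, smul_eq_mul, ← integral_const_mul]
        simp only [ContinuousMap.smul_apply, smul_eq_mul, mul_assoc] }
  have hΦ : Continuous Φ := by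
    refine AddMonoidHomClass.continuous_of_bound Φ
      (∫ t, ‖f t‖ ∂AddCircle.haarAddCircle) fun g => ?_
    refine (norm_integral_le_integral_norm _).trans ?_
    rw [mul_comm _ ‖g‖, ← integral_const_mul]
    refine integral_mono (hint g).norm (hf.norm.const_mul _) fun t => ?_
    simp only [norm_mul]
    exact mul_le_mul_of_nonneg_right (g.norm_coe_le_norm t) (norm_nonneg _)
  have hspan : Submodule.span ℂ (Set.range (@fourier (2 * Real.pi))) ≤ LinearMap.ker Φ := by
    rw [Submodule.span_le]
    rintro _ ⟨n, rfl⟩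
    have := h (-n)
    simp only [fourierCoeff, neg_neg, smul_eq_mul] at this
    exact this
  have htop := Submodule.topologicalClosure_minimal _ hspan (isClosed_singleton.preimage hΦ)
  rw [span_fourier_closure_eq_top] at htop
  exact htop (Submodule.mem_top : g ∈ _)

/-! ### Translations -/

theorem fourierCoeff_comp_sub (f : Torus → ℂ) (s : Torus) (n : ℤ) :
    fourierCoeff (fun t => f (t - s)) n = fourier (-n) s * fourierCoeff f n := by
  have h := integral_sub_right_eq_self (μ := (AddCircle.haarAddCircle : Measure Torus))
    (fun t => fourier (-n) (t + s) * f t) s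
  simp only [sub_add_cancel] at h
  simp only [fourierCoeff, smul_eq_mul]
  rw [h, ← integral_const_mul]
  refine integral_congr_ae (Eventually.of_forall fun t => ?_)
  simp only [fourier_apply, smul_add, AddCircle.toCircle_add, Circle.coe_mul]
  ring

/-! ### Translations and spectra in homogeneous Banach spaces -/

section Homogeneous

variable {X : Type*} [NormedAddCommGroup X] [NormedSpace ℂ X] {ι : X →ₗ[ℂ] L1}

theorem eq_of_ae_eq (hι : IsHomogeneous ι) {f g : X}
    (h : ι f =ᵐ[AddCircle.haarAddCircle] ι g) : f = g :=
  hι.injective (Lp.ext h)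

theorem comp_sub_ae_eq {f g : Torus → ℂ} (h : f =ᵐ[AddCircle.haarAddCircle] g) (s : Torus) :
    (fun t => f (t - s)) =ᵐ[AddCircle.haarAddCircle] fun t => g (t - s) :=
  (measurePreserving_sub_right AddCircle.haarAddCircle s).quasiMeasurePreserving.ae_eq_comp h

/-- The translate of an element of a homogeneous Banach space. -/
noncomputable def translate (hι : IsHomogeneous ι) (s : Torus) (f : X) : X :=
  (hι.translation f).choose s

theorem continuous_translate (hι : IsHomogeneous ι) (f : X) :
    Continuous fun s => translate hι s f :=
  (hι.translation f).choose_spec.1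

theorem norm_translate (hι : IsHomogeneous ι) (s : Torus) (f : X) : ‖translate hι s f‖ = ‖f‖ :=
  ((hι.translation f).choose_spec.2 s).1

theorem coe_translate (hι : IsHomogeneous ι) (s : Torus) (f : X) :
    ι (translate hι s f) =ᵐ[AddCircle.haarAddCircle] fun t => ι f (t - s) :=
  ((hι.translation f).choose_spec.2 s).2

theorem translate_zero (hι : IsHomogeneous ι) (f : X) : translate hι 0 f = f :=
  eq_of_ae_eq hι ((coe_translate hι 0 f).trans (by simp))

/-- Translation by `s`, as a linear isometry of a homogeneous Banach space. -/
noncomputable def translateₗᵢ (hι : IsHomogeneous ι) (s : Torus) : X →ₗᵢ[ℂ] X where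
  toFun := translate hι s
  map_add' f g := eq_of_ae_eq hι <| by
    have h := comp_sub_ae_eq (Lp.coeFn_add (ι f) (ι g)) s
    rw [← map_add] at h
    rw [map_add]
    refine (coe_translate hι s _).trans (h.trans ?_)
    exact ((coe_translate hι s f).symm.add (coe_translate hι s g).symm).trans
      (Lp.coeFn_add _ _).symm
  map_smul' c f := eq_of_ae_eq hι <| by
    have h := comp_sub_ae_eq (Lp.coeFn_smul c (ι f)) s
    rw [← map_smul] at h
    rw [RingHom.id_apply, map_smul]
    refine (coe_translate hι s _).trans (h.trans ?_)
    exact ((coe_translate hι s f).symm.const_smul c).trans (Lp.coeFn_smul _ _).symm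
  norm_map' := norm_translate hι s

/-- The `n`-th Fourier coefficient, as a linear form. -/
noncomputable def coeffₗ (ι : X →ₗ[ℂ] L1) (n : ℤ) : X →ₗ[ℂ] ℂ where
  toFun f := fourierCoeff (ι f : Torus → ℂ) n
  map_add' f g := by
    rw [map_add, fourierCoeff_congr_ae (Lp.coeFn_add _ _)]
    exact congrFun (fourierCoeff.add (L1.integrable_coeFn (ι f)) (L1.integrable_coeFn (ι g))) n
  map_smul' c f := by
    rw [map_smul, fourierCoeff_congr_ae (Lp.coeFn_smul _ _)]
    exact fourierCoeff.const_smul _ c n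

theorem coeffₗ_translate (hι : IsHomogeneous ι) (s : Torus) (f : X) (n : ℤ) :
    coeffₗ ι n (translate hι s f) = fourier (-n) s * coeffₗ ι n f := by
  change fourierCoeff _ n = _ * fourierCoeff _ n
  rw [fourierCoeff_congr_ae (coe_translate hι s f), fourierCoeff_comp_sub]

theorem eq_zero_of_coeffₗ_eq_zero (hι : IsHomogeneous ι) {f : X} (h : ∀ n, coeffₗ ι n f = 0) :
    f = 0 := by
  refine eq_of_ae_eq hι ?_
  rw [map_zero]
  exact (ae_eq_zero_of_fourierCoeff_eq_zero (L1.integrable_coeFn (ι f)) h).trans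
    (Lp.coeFn_zero ℂ 1 _).symm

/-- A space of functions whose spectrum lies in a fixed finite set is finite-dimensional. -/
theorem finiteDimensional_of_finite_spectrum (hι : IsHomogeneous ι) {V : Type*} [AddCommGroup V]
    [Module ℂ V] (j : V →ₗ[ℂ] X) (hj : Function.Injective j) {F : Set ℤ} (hF : F.Finite)
    (h : ∀ v, ∀ n ∉ F, coeffₗ ι n (j v) = 0) : FiniteDimensional ℂ V := by
  have := hF.to_subtype
  let Φ : V →ₗ[ℂ] (F → ℂ) := LinearMap.pi fun n => coeffₗ ι n ∘ₗ j
  refine FiniteDimensional.of_injective Φ ?_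
  rw [← LinearMap.ker_eq_bot, LinearMap.ker_eq_bot']
  intro v hv
  refine hj ?_
  rw [map_zero]
  refine eq_zero_of_coeffₗ_eq_zero hι fun n => ?_
  by_cases hn : n ∈ F
  · exact congrFun hv ⟨n, hn⟩
  · exact h v n hn

variable (E : Set ℤ)

/-- Translation by `s` on the space `X_E`. -/
noncomputable def translateSpectrum (hι : IsHomogeneous ι) (s : Torus) :
    withSpectrum ι E →ₗᵢ[ℂ] withSpectrum ι E where
  toLinearMap := (translateₗᵢ hι s).toLinearMap.restrict fun f hf n hn => by
    have h := coeffₗ_translate hι s f n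
    rw [show coeffₗ ι n f = 0 from hf n hn, mul_zero] at h
    exact h
  norm_map' f := norm_translate hι s f

/-- If translations by `s k → 0` act as `-1` on all but finitely many characters of `E`, then
`X_E` has the real metric unconditional approximation property. -/
theorem hasRealUMAP_withSpectrum_of_tendsto (hι : IsHomogeneous ι) {s : ℕ → Torus}
    (hs : Tendsto s atTop (𝓝 0))
    (hfin : ∀ k, {n ∈ E | fourier (-n) (s k) ≠ (-1 : ℂ)}.Finite) :
    HasRealUMAP (withSpectrum ι E) := by
  let U : ℕ → withSpectrum ι E →L[ℂ] withSpectrum ι E := fun k =>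
    (translateSpectrum E hι (s k)).toContinuousLinearMap
  refine hasRealUMAP_of_norm_one_sub_two_smul_le (S := fun k => (2⁻¹ : ℂ) • (1 + U k))
    (fun k => ?_) (fun f => ?_) fun k => ?_
  · refine finiteDimensional_of_finite_spectrum hι ((withSpectrum ι E).subtype ∘ₗ
      Submodule.subtype _) ((Submodule.subtype_injective _).comp (Submodule.subtype_injective _))
      (hfin k) ?_
    rintro ⟨_, f, rfl⟩ n hn
    change coeffₗ ι n ((2⁻¹ : ℂ) • ((f : X) + translate hι (s k) f)) = 0
    rw [map_smul, map_add, coeffₗ_translate]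
    -- The coefficient of index `n` has been multiplied by `(1 + fourier (-n) (s k)) / 2`, which is
    -- zero where translation acts as `-1`.
    by_cases hnE : n ∈ E
    · have : fourier (-n) (s k) = (-1 : ℂ) := by
        by_contra h
        exact hn ⟨hnE, h⟩
      rw [this]; simp
    · rw [show coeffₗ ι n f = 0 from f.2 n hnE]; simp
  · have hlim : Tendsto (fun k => U k f) atTop (𝓝 f) := by
      rw [tendsto_subtype_rng]
      have := ((continuous_translate hι (f : X)).tendsto 0).comp hs
      rw [translate_zero] at this
      exact this
    have := (hlim.const_add f).const_smul (2⁻¹ : ℂ)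
    rwa [← two_smul ℂ f, inv_smul_smul₀ two_ne_zero] at this
  · have : 1 - (2 : ℂ) • (2⁻¹ : ℂ) • (1 + U k) = -U k := by module
    rw [this, norm_neg]
    exact LinearIsometry.norm_toContinuousLinearMap_le _

theorem hasRealUMAP_withSpectrum_of_finite (hι : IsHomogeneous ι) (hE : E.Finite) :
    HasRealUMAP (withSpectrum ι E) := by
  have : FiniteDimensional ℂ (withSpectrum ι E) :=
    finiteDimensional_of_finite_spectrum hι (withSpectrum ι E).subtype
      (Submodule.subtype_injective _) hE fun v => v.2
  refine hasRealUMAP_of_norm_one_sub_two_smul_le (S := fun _ => 1) (fun _ => inferInstance)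
    (fun f => tendsto_const_nhds) fun _ => ?_
  have : (1 : withSpectrum ι E →L[ℂ] withSpectrum ι E) - (2 : ℂ) • 1 = -1 := by module
  rw [this, norm_neg]
  exact ContinuousLinearMap.norm_id_le

end Homogeneous

/-! ### Sequences with odd ratios -/

theorem fourier_pi_div_of_odd {a m : ℤ} (ha : a ≠ 0) (hm : Odd m) :
    fourier (-(m * a)) (((Real.pi / a : ℝ)) : Torus) = (-1 : ℂ) := by
  have hπ : (Real.pi : ℂ) ≠ 0 := Complex.ofReal_ne_zero.2 Real.pi_ne_zero
  have ha' : (a : ℂ) ≠ 0 := Int.cast_ne_zero.2 ha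
  rw [fourier_coe_apply]
  have : 2 * (Real.pi : ℂ) * Complex.I * ((-(m * a) : ℤ) : ℂ) * ((Real.pi / a : ℝ) : ℂ) /
      ((2 * Real.pi : ℝ) : ℂ) = ((-m : ℤ) : ℂ) * (Real.pi * Complex.I) := by
    push_cast
    field_simp
  rw [this, Complex.exp_int_mul, Complex.exp_pi_mul_I, hm.neg.neg_one_zpow]

theorem hasRealUMAP_withSpectrum_of_odd_ratio {X : Type*} [NormedAddCommGroup X]
    [NormedSpace ℂ X] {ι : X →ₗ[ℂ] L1} (hι : IsHomogeneous ι) {n : ℕ → ℤ} {K : ℕ}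
    (h : ∀ k ≥ K, ∃ m : ℤ, Odd m ∧ (n (k + 1) : ℚ) / (n k : ℚ) = (m : ℚ)) :
    HasRealUMAP (withSpectrum ι (Set.range n)) := by
  -- Division by zero gives `0`, which is not odd.
  have hne : ∀ k ≥ K, n k ≠ 0 := fun k hk h0 => by
    obtain ⟨m, hm, he⟩ := h k hk
    rw [h0, Int.cast_zero, div_zero] at he
    have : m = 0 := by exact_mod_cast he.symm
    subst this
    exact absurd hm (by decide)
  have hstep : ∀ k ≥ K, ∃ m : ℤ, Odd m ∧ n (k + 1) = m * n k := fun k hk => by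
    obtain ⟨m, hm, he⟩ := h k hk
    refine ⟨m, hm, ?_⟩
    rw [div_eq_iff (Int.cast_ne_zero.2 (hne k hk))] at he
    exact_mod_cast he
  have hodd : ∀ k ≥ K, ∀ j ≥ k, ∃ m : ℤ, Odd m ∧ n j = m * n k := fun k hk j hj => by
    induction j, hj using Nat.le_induction with
    | base => exact ⟨1, odd_one, (one_mul _).symm⟩
    | succ j hj ih =>
      obtain ⟨m, hm, he⟩ := ih
      obtain ⟨m', hm', he'⟩ := hstep j (hk.trans hj)
      exact ⟨m' * m, hm'.mul hm, by rw [he', he, mul_assoc]⟩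
  -- Ratios `±1` are allowed, so `E` may be finite; then `π / n k` need not tend to `0`.
  by_cases hE : (Set.range n).Finite
  · exact hasRealUMAP_withSpectrum_of_finite _ hι hE
  have hmono : Monotone fun k => (n (k + K)).natAbs := monotone_nat_of_le_succ fun k => by
    obtain ⟨m, hm, he⟩ := hstep (k + K) (Nat.le_add_left _ _)
    rw [show k + 1 + K = k + K + 1 by ring, he, Int.natAbs_mul]
    have : m ≠ 0 := by rintro rfl; exact absurd hm (by decide)
    exact Nat.le_mul_of_pos_left _ (Int.natAbs_pos.2 this)
  have hlim : Tendsto (fun k => (n (k + K)).natAbs) atTop atTop := by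
    refine tendsto_atTop_atTop_of_monotone hmono fun b => ?_
    -- If `|n k|` stayed below `b` for `k ≥ K`, the range would be finite.
    by_contra! hb
    refine hE (((Set.finite_lt_nat K).image n |>.union (Set.finite_Icc (-b : ℤ) b)).subset ?_)
    rintro _ ⟨k, rfl⟩
    by_cases hk : k < K
    · exact Or.inl ⟨k, hk, rfl⟩
    · right
      have := hb (k - K)
      rw [Nat.sub_add_cancel (not_lt.1 hk)] at this
      rw [Set.mem_Icc]
      omega
  refine hasRealUMAP_withSpectrum_of_tendsto _ hι
    (s := fun k => ((Real.pi / n (k + K) : ℝ) : Torus)) ?_ fun k => ?_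
  · have h1 : Tendsto (fun k => (Real.pi / n (k + K) : ℝ)) atTop (𝓝 0) := by
      rw [tendsto_zero_iff_norm_tendsto_zero]
      have := (tendsto_natCast_atTop_atTop (R := ℝ)).comp hlim
      refine (this.const_div_atTop ‖Real.pi‖).congr fun k => ?_
      rw [norm_div, Function.comp_apply, Nat.cast_natAbs, Int.cast_abs, Real.norm_eq_abs (n _ : ℝ)]
    exact ((AddCircle.continuous_mk' _).tendsto 0).comp h1
  · refine ((Set.finite_lt_nat (k + K)).image n).subset ?_
    rintro _ ⟨⟨j, rfl⟩, hj⟩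
    refine ⟨j, ?_, rfl⟩
    by_contra hjk
    obtain ⟨m, hm, he⟩ := hodd (k + K) (Nat.le_add_left _ _) j (not_lt.1 hjk)
    refine hj ?_
    rw [he]
    exact fourier_pi_div_of_odd (hne _ (Nat.le_add_left _ _)) hm

/-! ### Continuous functions -/

/-- The inclusion of the continuous functions into `L¹(𝕋)`. -/
noncomputable def continuousToL1 : C(Torus, ℂ) →ₗ[ℂ] L1 :=
  (ContinuousMap.toLp 1 AddCircle.haarAddCircle ℂ : C(Torus, ℂ) →L[ℂ] L1).toLinearMap

theorem coe_continuousToL1 (f : C(Torus, ℂ)) :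
    continuousToL1 f =ᵐ[AddCircle.haarAddCircle] f :=
  ContinuousMap.coeFn_toLp _ _

theorem isHomogeneous_continuousToL1 : IsHomogeneous continuousToL1 where
  injective := ContinuousMap.toLp_injective _
  norm_le f := by
    refine ((ContinuousMap.toLp 1 AddCircle.haarAddCircle ℂ :
      C(Torus, ℂ) →L[ℂ] L1).le_opNorm f).trans ?_
    refine mul_le_of_le_one_left (norm_nonneg _) ((ContinuousMap.toLp_norm_le _).trans ?_)
    simp [measureUnivNNReal]
  translation f := by
    -- Currying the jointly continuous map `(s, t) ↦ f (t - s)` gives continuity of translation in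
    -- the sup norm.
    let F : C(Torus × Torus, ℂ) := ⟨fun p => f (p.2 - p.1), by fun_prop⟩
    refine ⟨F.curry, F.curry.continuous, fun s => ⟨?_, ?_⟩⟩
    · refine le_antisymm ?_ ?_
      · exact (ContinuousMap.norm_le _ (norm_nonneg _)).2 fun t => f.norm_coe_le_norm _
      · refine (ContinuousMap.norm_le _ (norm_nonneg _)).2 fun t => ?_
        have := (F.curry s).norm_coe_le_norm (t + s)
        simpa [F] using this
    · exact (coe_continuousToL1 _).trans (comp_sub_ae_eq (coe_continuousToL1 f).symm s)

theorem continuousWithSpectrum_eq (E : Set ℤ) :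
    continuousWithSpectrum E = withSpectrum continuousToL1 E := by
  ext f
  change (∀ n ∉ E, _ = _) ↔ ∀ n ∉ E, _ = _
  simp only [fourierCoeff_congr_ae (coe_continuousToL1 f)]

end UnconditionalApproximation

theorem proposition10p1 :
    (∀ n : ℕ → ℤ,
      (∃ K : ℕ, ∀ k ≥ K, ∃ m : ℤ, Odd m ∧ (n (k + 1) : ℚ) / (n k : ℚ) = (m : ℚ)) →
        HasRealUMAP (continuousWithSpectrum (Set.range n)) ∧
        ∀ (X : Type*) [NormedAddCommGroup X] [NormedSpace ℂ X] [CompleteSpace X]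
          (ι : X →ₗ[ℂ] L1), IsHomogeneous ι →
            HasRealUMAP (withSpectrum ι (Set.range n))) ∧
    HasRealUMAP (continuousWithSpectrum (Set.range fun k : ℕ => (3 : ℤ) ^ k)) := by
  have hC : ∀ n : ℕ → ℤ,
      (∃ K : ℕ, ∀ k ≥ K, ∃ m : ℤ, Odd m ∧ (n (k + 1) : ℚ) / (n k : ℚ) = (m : ℚ)) →
        HasRealUMAP (continuousWithSpectrum (Set.range n)) := fun n ⟨K, h⟩ => by
    rw [continuousWithSpectrum_eq]
    exact hasRealUMAP_withSpectrum_of_odd_ratio isHomogeneous_continuousToL1 h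
  refine ⟨fun n hn => ⟨hC n hn, fun X _ _ _ ι hι => ?_⟩, hC _ ⟨0, fun k _ => ⟨3, by decide, ?_⟩⟩⟩
  · obtain ⟨K, h⟩ := hn
    exact hasRealUMAP_withSpectrum_of_odd_ratio hι h
  · push_cast
    rw [pow_succ]
    field_simp
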